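/- **Setting.** An *alternating timed automaton* (ATA) $A=(Q,\Sigma,\delta,q_0,Q_{acc},X,\mathcal G)$ has finite sets $Q$ of locations, $\Sigma$ of letters, $X$ of clocks, and $\delta:Q\times\Sigma\to\Phi(Q,\mathcal G)$, where formulas are built by $\wedge,\vee$ from $\top$, $\bot$, guards $x\in I$ ($I$ an interval with end points in $\mathbb Z_{\ge0}\cup\{\infty\}$) and $Y.q$ ($q\in Q$, $Y\subseteq X$; $q$ stands for $\emptyset.q$). A state is a pair $(q,\nu)$ with $\nu:X\to\mathbb R_{\ge0}$; a configuration is a finite set of states. $C\models_\nu Y.q$ iff $(q,\nu[Y:=0])\in C$, and $C\models_\nu x\in I$ iff $\nu(x)\in I$. A successor of $(q,\nu)$ under $(t,a)$ is a minimal $C$ with $C\models_{\nu+t}\delta(q,a)$, and $C\xrightarrow{(t,a)}C'$ iff $C'$ is a union of one successor for each state of $C$. $TS(A)$ is the transition system on configurations with these steps, initial configuration $\{(q_0,\mathbf 0)\}$, and as final ones those all of whose locations are in $Q_{acc}$. $L_{fin}(A)$ (resp. $L_{inf}(A)$) is the set of finite timed words (resp. infinite timed words whose time stamps tend to $\infty$),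 with non-decreasing time stamps, that have a run in $TS(A)$ ending in (resp. visiting infinitely often) final configurations. Two transition systems are *simulation equivalent* if each has a simulation into the other that relates the initial states and preserves final states. $A$ is a *nondeterministic timed automaton* if every $\delta(q,a)$ is a disjunction of formulas $Y.q'\wedge\gamma$ with $\gamma$ a conjunction of guards. $A$ is *unilateral* for a partition $Q=Q^{\ge}\sqcup Q^{\le}$ if all guards in $\delta(q,a)$ use intervals $[l,\infty)$ or $(l,\infty)$ when $q\in Q^{\ge}$, and $[0,u]$ or $[0,u)$ with $u\geq 1$ when $q\in Q^{\le}$, and every transition between the two parts resets all of $X$. $A$ is *very weak* if there is a partial order on $Q$ with $q\le p$ whenever some $Y.q$ occurs in some $\delta(p,a)$; self-loops reset nothing; each $q$ has transitions from at most one $p\ne q$; and all transitions from $p$ to $q$ reset the same clocks. **Reduced system.** $(q,\nu)\preceq(q,\nu')$ means $\nu\le\nu'$ if $q\in Q^{\ge}$ and $\nu'\le\nu$ if $q\in Q^{\le}$. $\mathrm{Red}(C)$ deletes from $C$ all $s'$ for which there is $s\in C$, $s\ne s'$, $s\preceq s'$. $T_{red}(A)$ has the configurations as states, the initial state $\mathrm{Red}(\{(q_0,\mathbf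 0)\})$, the same final configurations, and a step $D\xrightarrow{(t,a)}D'$ iff $D=\mathrm{Red}(C)$, $D'=\mathrm{Red}(C')$ for some $C\xrightarrow{(t,a)}C'$ in $TS(A)$. Let $T'_{red}(A)$ be the variant in which only $C=D$ is allowed. **Construction of $\mathbb A$.** Locations are pairs $(L,\mathsf{Act})$, where $L$ maps each $q\in Q$ either to $0$ ("absent") or to a function $L(q):X\to\{0,\dots,|Q|-1\}$, and $\mathsf{Act}$ maps each $x\in X$ to a duplicate-free sequence over $\{0,\dots,|Q|-1\}$. The clocks are $X\times\{0,\dots,|Q|-1\}$. Initially $L_0(q_0)\equiv 0$, all other locations are absent, and $\mathsf{Act}_0(x)=[0]$. $(L,\mathsf{Act})$ is accepting iff all present locations are in $Q_{acc}$. $\Delta((L,\mathsf{Act}),a)$ is the disjunction, over all choices $C$ of one clause $C_i$ of the disjunctive normal form of $\delta(q_i,a)$ for each present $q_i$, of $Y_C.(L_C,\mathsf{Act}_C)\wedge\bigwedge G_C$, where: * $G_C$ consists of $(x,L(q_i)(x))\in I$ for every guard $x\in I$ in $C_i$. * For every $q$ that occurs in $C$, one occurrence $Y.q$ in some $C_i$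 is kept (if $q$ does not occur, it is absent in $L_C$). *Very weak case:* if there is a choice, for $q\in Q^{\le}$ the self-loop is kept, for $q\in Q^{\ge}$ the one from the other location. *One-clock case:* for $q\in Q^{\le}$ the one with the oldest clock, for $q\in Q^{\ge}$ the one with the most recently reset clock, where a clock reset by the occurrence is most recent and otherwise age is read off the position of $L(q_i)(x)$ in $\mathsf{Act}(x)$ (older copies first). * For the kept $Y.q$ from $C_i$ and $x\notin Y$, $L_C(q)(x)=L(q_i)(x)$. For $x\in Y$, $L_C(q)(x)$ is copy $0$ if all transitions in $C$ reset $x$; otherwise it is $L(q_i)(x)$ if all transitions in the clauses $C_k$ with $L(q_k)(x)=L(q_i)(x)$ reset $x$; otherwise it is the smallest number not among the members of $\mathsf{Act}(x)$ that are inherited without reset by a kept transition. In these cases $(x,L_C(q)(x))$ is put into $Y_C$. * $\mathsf{Act}_C(x)$ lists the members of $\mathsf{Act}(x)$ inherited without reset by a kept transition, in their old order, omitting those just reset, followed by the copies of $x$ just reset (in increasing order). **Proposition.** Let $A$ be an ATA that is unilateral for $Q=Q^{\ge}\sqcup Q^{\le}$ and is very weak or has exactly one clock, and let $\mathbb A$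 be constructed from it as above (by the rule for the respective case). Then $\mathbb A$ is a nondeterministic timed automaton, $TS(\mathbb A)$ is simulation equivalent to $T_{red}(A)$ (and to $T'_{red}(A)$), and hence $L_{fin}(A)=L_{fin}(\mathbb A)$ and $L_{inf}(A)=L_{inf}(\mathbb A)$. -/

import Mathlib

open Filter
open scoped NNReal

namespace TimedATA

/-! ### Labelled transition systems and simulations -/

/-- A labelled transition system with an initial state and a set of final states. -/
structure LTS (S Lab : Type*) where
  init : S
  step : S → Lab → S → Prop
  final : Set S

/-- `T.Run s w s'`: there is a finite run of `T` from `s` to `s'` labelled by `w`. -/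
inductive LTS.Run {S Lab : Type*} (T : LTS S Lab) : S → List Lab → S → Prop
  | nil (s : S) : LTS.Run T s [] s
  | cons {s s' s'' : S} {l : Lab} {w : List Lab} :
      T.step s l s' → LTS.Run T s' w s'' → LTS.Run T s (l :: w) s''

/-- Some run on the finite word `w` from the initial state ends in a final state. -/
def LTS.Accepts {S Lab : Type*} (T : LTS S Lab) (w : List Lab) : Prop :=
  ∃ s ∈ T.final, T.Run T.init w s

/-- Some run on the infinite word `w` from the initial state visits the final states
infinitely often. -/
def LTS.BuchiAccepts {S Lab : Type*} (T : LTS S Lab) (w : ℕ → Lab) : Prop :=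
  ∃ r : ℕ → S, r 0 = T.init ∧ (∀ i, T.step (r i) (w i) (r (i + 1))) ∧
    ∃ᶠ i in atTop, r i ∈ T.final

/-- `R` is a simulation relation: whenever `R s₁ s₂`, the state `s₂` simulates `s₁`. -/
structure LTS.IsSimulation {S₁ S₂ Lab : Type*} (T₁ : LTS S₁ Lab) (T₂ : LTS S₂ Lab)
    (R : S₁ → S₂ → Prop) : Prop where
  init : R T₁.init T₂.init
  final : ∀ s₁ s₂, R s₁ s₂ → s₁ ∈ T₁.final → s₂ ∈ T₂.final
  step : ∀ s₁ s₂, R s₁ s₂ → ∀ l s₁', T₁.step s₁ l s₁' →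
    ∃ s₂', T₂.step s₂ l s₂' ∧ R s₁' s₂'

/-- Each of the two systems simulates the other. -/
def LTS.SimEquiv {S₁ S₂ Lab : Type*} (T₁ : LTS S₁ Lab) (T₂ : LTS S₂ Lab) : Prop :=
  (∃ R, T₁.IsSimulation T₂ R) ∧ (∃ R, T₂.IsSimulation T₁ R)

/-! ### Timed words -/

/-- The timed letters `(τᵢ - τᵢ₋₁, σᵢ)` of a finite timed word, the preceding time being `τ₀`. -/
def letters {Sig : Type*} : ℝ≥0 → List (Sig × ℝ≥0) → List (ℝ≥0 × Sig)
  | _, [] => []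
  | τ₀, (a, τ) :: ρ => (τ - τ₀, a) :: letters τ ρ

/-- The timed letters of an infinite timed word, the time before the first letter being `0`. -/
def infLetters {Sig : Type*} (ρ : ℕ → Sig × ℝ≥0) : ℕ → ℝ≥0 × Sig
  | 0 => ((ρ 0).2, (ρ 0).1)
  | i + 1 => ((ρ (i + 1)).2 - (ρ i).2, (ρ (i + 1)).1)

/-- Finite timed words: the time stamps are non-decreasing. -/
def IsTimedWord {Sig : Type*} (ρ : List (Sig × ℝ≥0)) : Prop :=
  ρ.Pairwise fun p p' => p.2 ≤ p'.2

/-- Infinite timed words: the time stamps are non-decreasing and tend to infinity. -/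
def IsInfTimedWord {Sig : Type*} (ρ : ℕ → Sig × ℝ≥0) : Prop :=
  (Monotone fun i => (ρ i).2) ∧ Tendsto (fun i => (ρ i).2) atTop atTop

/-! ### Alternating timed automata -/

/-- Intervals of non-negative reals with end points in `ℕ ∪ {∞}`; the Booleans tell whether
the lower and the upper end point belong to the interval. -/
inductive TimeInterval
  | bounded (l u : ℕ) (lclosed uclosed : Bool)
  | unbounded (l : ℕ) (lclosed : Bool)

def TimeInterval.toSet : TimeInterval → Set ℝ≥0
  | .bounded l u lc uc =>
      {t | (if lc then (l : ℝ≥0) ≤ t else (l : ℝ≥0) < t) ∧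
        (if uc then t ≤ (u : ℝ≥0) else t < (u : ℝ≥0))}
  | .unbounded l lc => {t | if lc then (l : ℝ≥0) ≤ t else (l : ℝ≥0) < t}

/-- The intervals `[l, ∞)` and `(l, ∞)`. -/
def TimeInterval.IsLeftSided (I : TimeInterval) : Prop :=
  ∃ l lc, I = .unbounded l lc

/-- The intervals `[0, u]` and `[0, u)` with `u > 0`. -/
def TimeInterval.IsRightSided (I : TimeInterval) : Prop :=
  ∃ u uc, 0 < u ∧ I = .bounded 0 u true uc

/-- Transition formulas. The formula `move Y q` is `Y.q` (go to `q`, resetting the clocks in `Y`);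
the formula `q` without reset is `move ∅ q`. -/
inductive Formula (Q X : Type*)
  | tt
  | ff
  | and (φ ψ : Formula Q X)
  | or (φ ψ : Formula Q X)
  | guard (x : X) (I : TimeInterval)
  | move (Y : Set X) (q : Q)

/-- `Y.q` occurs in the formula. -/
def Formula.HasMove {Q X : Type*} (Y : Set X) (q : Q) : Formula Q X → Prop
  | .tt => False
  | .ff => False
  | .and φ ψ => φ.HasMove Y q ∨ ψ.HasMove Y q
  | .or φ ψ => φ.HasMove Y q ∨ ψ.HasMove Y q
  | .guard _ _ => False
  | .move Y' q' => Y' = Y ∧ q' = q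

/-- The guard `x ∈ I` occurs in the formula. -/
def Formula.HasGuard {Q X : Type*} (x : X) (I : TimeInterval) : Formula Q X → Prop
  | .tt => False
  | .ff => False
  | .and φ ψ => φ.HasGuard x I ∨ ψ.HasGuard x I
  | .or φ ψ => φ.HasGuard x I ∨ ψ.HasGuard x I
  | .guard x' I' => x' = x ∧ I' = I
  | .move _ _ => False

/-- A state: a location and a clock valuation. -/
abbrev State (Q X : Type*) := Q × (X → ℝ≥0)

/-- A configuration: a finite set of states. -/
abbrev Config (Q X : Type*) := Finset (State Q X)

open Classical in
/-- The valuation `ν` with the clocks in `Y` set to `0`. -/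
noncomputable def resetVal {X : Type*} (ν : X → ℝ≥0) (Y : Set X) : X → ℝ≥0 :=
  fun x => if x ∈ Y then 0 else ν x

/-- `C ⊨_ν φ`. -/
def Formula.Sat {Q X : Type*} (C : Config Q X) (ν : X → ℝ≥0) : Formula Q X → Prop
  | .tt => True
  | .ff => False
  | .and φ ψ => φ.Sat C ν ∧ ψ.Sat C ν
  | .or φ ψ => φ.Sat C ν ∨ ψ.Sat C ν
  | .guard x I => ν x ∈ I.toSet
  | .move Y q => (q, resetVal ν Y) ∈ C

/-- `C` is a minimal model of `φ` with respect to `ν`. -/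
def Formula.IsMinModel {Q X : Type*} (φ : Formula Q X) (C : Config Q X) (ν : X → ℝ≥0) : Prop :=
  φ.Sat C ν ∧ ∀ C' : Config Q X, C' ⊂ C → ¬ φ.Sat C' ν

/-- An alternating timed automaton with locations `Q`, alphabet `Sig` and clocks `X`
(its guards are those that occur in `δ`). -/
structure ATA (Q Sig X : Type*) where
  δ : Q → Sig → Formula Q X
  q₀ : Q
  acc : Set Q

namespace ATA

variable {Q Sig X : Type*}

/-- The successors of a state on delay `t` followed by `a`. -/
def Succ (A : ATA Q Sig X) (s : State Q X) (t : ℝ≥0) (a : Sig) : Set (Config Q X) :=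
  {C | (A.δ s.1 a).IsMinModel C (fun x => s.2 x + t)}

/-- `C →(t,a) C'`: `C'` is a union of successors, one for each state of `C`. -/
def Step (A : ATA Q Sig X) (C : Config Q X) (l : ℝ≥0 × Sig) (C' : Config Q X) : Prop :=
  ∃ f : State Q X → Config Q X, (∀ s ∈ C, f s ∈ A.Succ s l.1 l.2) ∧
    (C' : Set (State Q X)) = ⋃ s ∈ C, (f s : Set (State Q X))

/-- The accepting configurations. -/
def accConfigs (A : ATA Q Sig X) : Set (Config Q X) :=
  {C | ∀ s ∈ C, s.1 ∈ A.acc}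

/-- The transition system `TS(A)`. -/
def ts (A : ATA Q Sig X) : LTS (Config Q X) (ℝ≥0 × Sig) where
  init := {(A.q₀, fun _ => 0)}
  step := A.Step
  final := A.accConfigs

/-- The language of finite timed words. -/
def finLang (A : ATA Q Sig X) : Set (List (Sig × ℝ≥0)) :=
  {ρ | IsTimedWord ρ ∧ A.ts.Accepts (letters 0 ρ)}

/-- The language of infinite timed words (Büchi acceptance). -/
def infLang (A : ATA Q Sig X) : Set (ℕ → Sig × ℝ≥0) :=
  {ρ | IsInfTimedWord ρ ∧ A.ts.BuchiAccepts (infLetters ρ)}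

/-- There is a transition from `p` to `q` that resets `Y`. -/
def Edge (A : ATA Q Sig X) (p : Q) (Y : Set X) (q : Q) : Prop :=
  ∃ a, (A.δ p a).HasMove Y q

/-- `A` is very weak: transitions descend in a partial order, self-loops reset nothing, every
location is entered from at most one other location, and always with the same resets. -/
structure IsVeryWeak (A : ATA Q Sig X) : Prop where
  order : ∃ _ : PartialOrder Q, ∀ p Y q, A.Edge p Y q → q ≤ p
  loop : ∀ q Y, A.Edge q Y q → Y = ∅
  parent : ∀ q p p' Y Y', p ≠ q → p' ≠ q → A.Edge p Y q → A.Edge p' Y' q → p = p'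
  resets : ∀ p q Y Y', A.Edge p Y q → A.Edge p Y' q → Y = Y'

/-- `A` is an ATA with unilateral intervals, for the partition of its locations into
`Q^≥ = ge` and `Q^≤ = geᶜ`. -/
structure IsUnilateral (A : ATA Q Sig X) (ge : Set Q) : Prop where
  left : ∀ q ∈ ge, ∀ a x I, (A.δ q a).HasGuard x I → I.IsLeftSided
  right : ∀ q ∉ ge, ∀ a x I, (A.δ q a).HasGuard x I → I.IsRightSided
  cross : ∀ p Y q, A.Edge p Y q → ¬ (p ∈ ge ↔ q ∈ ge) → Y = Set.univ

end ATA

/-! ### Nondeterministic timed automata -/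

/-- A conjunction of guards. -/
def Formula.IsGuardConj {Q X : Type*} : Formula Q X → Prop
  | .tt => True
  | .guard _ _ => True
  | .and φ ψ => φ.IsGuardConj ∧ ψ.IsGuardConj
  | _ => False

/-- A disjunction of formulas `Y.q ∧ γ` with `γ` a conjunction of guards. -/
def Formula.IsNondet {Q X : Type*} : Formula Q X → Prop
  | .ff => True
  | .or φ ψ => φ.IsNondet ∧ ψ.IsNondet
  | .and (.move _ _) γ => γ.IsGuardConj
  | _ => False

/-- `A` is a nondeterministic timed automaton. -/
def ATA.IsNTA {Q Sig X : Type*} (A : ATA Q Sig X) : Prop :=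
  ∀ q a, (A.δ q a).IsNondet

/-! ### The reduced transition system -/

/-- The relation `s ⪯ s'`: the locations agree, and the clock values of the second state are at
least (in `Q^≥`), respectively at most (in `Q^≤`), those of the first. -/
def StatePrec {Q X : Type*} (ge : Set Q) (s s' : State Q X) : Prop :=
  s.1 = s'.1 ∧ (s.1 ∈ ge → s.2 ≤ s'.2) ∧ (s.1 ∉ ge → s'.2 ≤ s.2)

open Classical in
/-- Delete from `C` every state `s'` for which `C` has a state `s ≠ s'` with `s ⪯ s'`. -/
noncomputable def red {Q X : Type*} (ge : Set Q) (C : Config Q X) : Config Q X :=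
  C.filter fun s' => ¬ ∃ s ∈ C, s ≠ s' ∧ StatePrec ge s s'

/-- The reduced transition system: the image of `TS(A)` under `red`. -/
noncomputable def ATA.redTS {Q Sig X : Type*} (A : ATA Q Sig X) (ge : Set Q) :
    LTS (Config Q X) (ℝ≥0 × Sig) where
  init := red ge A.ts.init
  step D l D' := ∃ C C', A.ts.step C l C' ∧ D = red ge C ∧ D' = red ge C'
  final := A.accConfigs

/-- The variant of the reduced transition system in which a step is a step of `TS(A)` from the
reduced configuration itself, followed by a reduction. -/
noncomputable def ATA.redRunTS {Q Sig X : Type*} (A : ATA Q Sig X) (ge : Set Q) :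
    LTS (Config Q X) (ℝ≥0 × Sig) where
  init := red ge A.ts.init
  step D l D' := ∃ C', A.ts.step D l C' ∧ D' = red ge C'
  final := A.accConfigs

/-! ### The subset-like construction -/

/-- A conjunctive clause: a conjunction of guards `x ∈ I` and of transitions `Y.q`. -/
structure Clause (Q X : Type*) where
  guards : List (X × TimeInterval)
  moves : List (Set X × Q)

/-- The clauses of the disjunctive normal form. -/
def Formula.dnf {Q X : Type*} : Formula Q X → List (Clause Q X)
  | .tt => [⟨[], []⟩]
  | .ff => []
  | .and φ ψ => φ.dnf.flatMap fun c => ψ.dnf.map fun d =>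
      ⟨c.guards ++ d.guards, c.moves ++ d.moves⟩
  | .or φ ψ => φ.dnf ++ ψ.dnf
  | .guard x I => [⟨[(x, I)], []⟩]
  | .move Y q => [⟨[], [(Y, q)]⟩]

/-- The numbers `0, …, |Q| - 1` of the copies of each clock. -/
abbrev Copy (Q : Type*) [Fintype Q] := Fin (Fintype.card Q)

/-- The locations `(L, Act)` of the constructed automaton. `L q = none` means that `q` is absent,
and `L q = some v` that `q` is present and reads the copy `(x, v x)` of every clock `x`; `Act x`
lists the copies of `x` in use, in the order of their last resets, the oldest first. -/
abbrev Loc (Q X : Type*) [Fintype Q] :=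
  (Q → Option (X → Copy Q)) × (X → {l : List (Copy Q) // l.Nodup})

/-- A transition `Y.q` chosen in the clause of the present location `src`. -/
structure Arrow (Q X : Type*) where
  src : Q
  reset : Set X
  tgt : Q

section Construction

variable {Q Sig X : Type*} [Fintype Q]

/-- The copy number `0`; the argument shows that `Q` is not empty. -/
def zeroCopy (q : Q) : Copy Q := ⟨0, Fintype.card_pos_iff.mpr ⟨q⟩⟩

/-- The copy `L(q)(x)` (with the irrelevant value `0` if `q` is absent). -/
def copyOf (ℓ : Loc Q X) (q : Q) (x : X) : Copy Q :=
  match ℓ.1 q with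
  | some v => v x
  | none => zeroCopy q

/-- All ways to choose one clause of `δ(q, a)` for every present location `q`. Each choice is
a list of pairs (present location, its clause). -/
noncomputable def choices (A : ATA Q Sig X) (ℓ : Loc Q X) (a : Sig) :
    List (List (Q × Clause Q X)) :=
  List.sections (((Finset.univ.filter fun q => (ℓ.1 q).isSome).toList).map fun q =>
    (A.δ q a).dnf.map fun c => (q, c))

/-- All transitions in the chosen clauses. -/
def arrows (C : List (Q × Clause Q X)) : List (Arrow Q X) :=
  C.flatMap fun p => p.2.moves.map fun m => ⟨p.1, m.1, m.2⟩

/-- A rule that tells which of two transitions into the same location is preferred: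
`rule ℓ e e'` means that `e` is at least as good as `e'`. -/
abbrev Rule (Q X : Type*) [Fintype Q] := Loc Q X → Arrow Q X → Arrow Q X → Prop

/-- Into a location of `Q^≤` the self-loop is preferred, into a location of `Q^≥` the transition
from the other location. -/
def selfLoopRule (ge : Set Q) : Rule Q X := fun _ e e' =>
  (e.tgt ∈ ge → e.src = e.tgt → e'.src = e'.tgt) ∧
  (e.tgt ∉ ge → e'.src = e'.tgt → e.src = e.tgt)

open Classical in
/-- How recently the clock `x` was reset along `e`, according to the order `Act x`:
the position of the inherited copy in `Act x`, or `⊤` if `e` itself resets `x`. -/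
noncomputable def recency (ℓ : Loc Q X) (e : Arrow Q X) (x : X) : ℕ∞ :=
  if x ∈ e.reset then ⊤ else ((ℓ.2 x).1.idxOf (copyOf ℓ e.src x) : ℕ)

/-- Into a location of `Q^≤` the transition with the oldest clocks is preferred, into a location
of `Q^≥` the one with the most recently reset clocks. -/
def ageRule (ge : Set Q) : Rule Q X := fun ℓ e e' =>
  (e.tgt ∈ ge → ∀ x, recency ℓ e' x ≤ recency ℓ e x) ∧
  (e.tgt ∉ ge → ∀ x, recency ℓ e x ≤ recency ℓ e' x)

open Classical in
/-- The transition into `q` that is kept: the best one among all transitions into `q`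
in the chosen clauses (`none` if there is no transition into `q`). -/
noncomputable def kept (rule : Rule Q X) (ℓ : Loc Q X) (C : List (Q × Clause Q X)) (q : Q) :
    Option (Arrow Q X) :=
  (arrows C).find? fun e =>
    e.tgt = q ∧ ∀ e' ∈ arrows C, e'.tgt = q → rule ℓ e e'

open Classical in
/-- The active copies of `x` that are inherited without reset along a kept transition. -/
noncomputable def stay (rule : Rule Q X) (ℓ : Loc Q X) (C : List (Q × Clause Q X)) (x : X) :
    List (Copy Q) :=
  (ℓ.2 x).1.filter fun w =>
    ∃ q e, kept rule ℓ C q = some e ∧ x ∉ e.reset ∧ copyOf ℓ e.src x = w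

/-- The smallest copy number of `x` that is not in use (the default is never needed for a kept
transition that resets `x`). -/
noncomputable def fresh (rule : Rule Q X) (ℓ : Loc Q X) (C : List (Q × Clause Q X)) (q : Q)
    (x : X) : Copy Q :=
  ((List.finRange (Fintype.card Q)).find? fun w => w ∉ stay rule ℓ C x).getD (zeroCopy q)

open Classical in
/-- The copy of `x` that the target of a kept transition `e` will read. Without reset it is
inherited from the source. With reset it is copy `0` if all chosen transitions reset `x`; else
the copy of the source if all transitions from locations reading this copy reset `x`; else
a fresh copy. -/
noncomputable def newCopy (rule : Rule Q X) (ℓ : Loc Q X) (C : List (Q × Clause Q X))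
    (e : Arrow Q X) (x : X) : Copy Q :=
  if x ∉ e.reset then copyOf ℓ e.src x
  else if ∀ e' ∈ arrows C, x ∈ e'.reset then zeroCopy e.src
  else if ∀ p ∈ C, copyOf ℓ p.1 x = copyOf ℓ e.src x → ∀ m ∈ p.2.moves, x ∈ m.1 then
    copyOf ℓ e.src x
  else fresh rule ℓ C e.src x

/-- The clock copies that are reset. -/
def resetCopies (rule : Rule Q X) (ℓ : Loc Q X) (C : List (Q × Clause Q X)) :
    Set (X × Copy Q) :=
  {xw | ∃ q e, kept rule ℓ C q = some e ∧ xw.1 ∈ e.reset ∧ newCopy rule ℓ C e xw.1 = xw.2}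

open Classical in
/-- The new list of active copies of `x`: the inherited ones in their old order, then those
that have just been reset. -/
noncomputable def nextAct (rule : Rule Q X) (ℓ : Loc Q X) (C : List (Q × Clause Q X)) (x : X) :
    {l : List (Copy Q) // l.Nodup} :=
  ⟨((stay rule ℓ C x).filter fun w => (x, w) ∉ resetCopies rule ℓ C) ++
      ((List.finRange (Fintype.card Q)).filter fun w => (x, w) ∈ resetCopies rule ℓ C), by
    refine List.Nodup.append (((ℓ.2 x).2.filter _).filter _)
      ((List.nodup_finRange _).filter _) ?_
    intro w h₁ h₂
    simp only [List.mem_filter, decide_eq_true_eq] at h₁ h₂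
    exact h₁.2 h₂.2⟩

/-- The successor location. -/
noncomputable def nextLoc (rule : Rule Q X) (ℓ : Loc Q X) (C : List (Q × Clause Q X)) :
    Loc Q X :=
  (fun q => (kept rule ℓ C q).map fun e => newCopy rule ℓ C e, nextAct rule ℓ C)

/-- The conjunction of the guards of the chosen clauses, each one read on the clock copies of the
location from whose clause it comes. -/
def guardConj (ℓ : Loc Q X) (C : List (Q × Clause Q X)) : Formula (Loc Q X) (X × Copy Q) :=
  ((C.flatMap fun p => p.2.guards.map fun g => Formula.guard (g.1, copyOf ℓ p.1 g.1) g.2)).foldr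
    Formula.and Formula.tt

open Classical in
/-- The constructed timed automaton: locations `(L, Act)`, clocks `X × {0, …, |Q| - 1}`, and one
disjunct for every choice of clauses. -/
noncomputable def subsetNTA (A : ATA Q Sig X) (rule : Rule Q X) :
    ATA (Loc Q X) Sig (X × Copy Q) where
  δ ℓ a := ((choices A ℓ a).map fun C =>
    Formula.and (Formula.move (resetCopies rule ℓ C) (nextLoc rule ℓ C)) (guardConj ℓ C)).foldr
      Formula.or Formula.ff
  q₀ := (fun q => if q = A.q₀ then some fun _ => zeroCopy A.q₀ else none,
    fun _ => ⟨[zeroCopy A.q₀], List.nodup_singleton _⟩)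
  acc := {ℓ | ∀ q, (ℓ.1 q).isSome → q ∈ A.acc}

end Construction

end TimedATA

/-!
Why `𝔸 = subsetNTA A rule` simulates and is simulated by the reduced systems.

Order states by `StatePrec`. Since the guards are unilateral and a transition between the two parts
of the locations resets everything, a state higher in this order can satisfy at least as many
guards, and it keeps this advantage along every transition. Hence the lifting `Dominates` of the
order to configurations (every state of the second configuration is above one of the first) is a
simulation of `TS(A)` by itself (`ATA.IsUnilateral.step_of_dominates`). A configuration and its
reduction dominate each other, so that `TS(A)` is simulation equivalent to both reduced systems. It
remains to compare `TS(A)` with `𝔸`.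

A state `(ℓ, ν)` of `𝔸` stands for the configuration `conf ℓ ν`, with one state per present
location. Two facts make a step of `𝔸` compute what it should. First, the clock copies are
managed correctly (`readVal_nextLoc`): a copy inherited without reset is never reset at the same
time, because a fresh copy exists whenever one is needed; fewer than `|Q|` copies are inherited
if some kept transition resets the clock. Thus `conf` of the next state consists of the targets of
the kept transitions. As this is a subset of the targets of all chosen transitions, `𝔸` simulates
`TS(A)` for any rule (`exists_step_subsetNTA`). Secondly, the kept transition into a location leads
to the lowest of all states reached there (`SelectsLowest`), hence the kept targets dominate all
targets, and `TS(A)` simulates `𝔸` (`SelectsLowest.exists_step`).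

The second fact rests on an invariant. In a very weak automaton, a present location always reads
values at least as large as those it would read if entered anew from a present ancestor
(`OlderThanAncestors`). So staying in a location gives larger values than entering it from its
parent, as `selfLoopRule` presumes. In the one-clock case, `Act` lists the copies by decreasing
value (`SortedByAge`), so that positions in `Act` reflect the order of the values, and this order
is total.
-/

namespace TimedATA

/-! ### Simulations and languages -/

namespace LTS

variable {S₁ S₂ S₃ Lab : Type*} {T₁ : LTS S₁ Lab} {T₂ : LTS S₂ Lab} {T₃ : LTS S₃ Lab}

theorem IsSimulation.comp {R : S₁ → S₂ → Prop} {R' : S₂ → S₃ → Prop}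
    (h : T₁.IsSimulation T₂ R) (h' : T₂.IsSimulation T₃ R') :
    T₁.IsSimulation T₃ fun s u => ∃ v, R s v ∧ R' v u where
  init := ⟨_, h.init, h'.init⟩
  final := fun _ _ ⟨_, hv, hv'⟩ hs => h'.final _ _ hv' (h.final _ _ hv hs)
  step := by
    rintro s u ⟨v, hv, hv'⟩ l s' hs
    obtain ⟨v', hvv', hR⟩ := h.step _ _ hv _ _ hs
    obtain ⟨u', huu', hR'⟩ := h'.step _ _ hv' _ _ hvv'
    exact ⟨u', huu', v', hR, hR'⟩

theorem SimEquiv.symm (h : T₁.SimEquiv T₂) : T₂.SimEquiv T₁ := ⟨h.2, h.1⟩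

theorem SimEquiv.trans (h : T₁.SimEquiv T₂) (h' : T₂.SimEquiv T₃) : T₁.SimEquiv T₃ := by
  obtain ⟨⟨R₁, h₁⟩, R₂, h₂⟩ := h
  obtain ⟨⟨R₁', h₁'⟩, R₂', h₂'⟩ := h'
  exact ⟨⟨_, h₁.comp h₁'⟩, _, h₂'.comp h₂⟩

theorem IsSimulation.run {R : S₁ → S₂ → Prop} (h : T₁.IsSimulation T₂ R) {s s' : S₁}
    {w : List Lab} (hr : T₁.Run s w s') : ∀ u, R s u → ∃ u', T₂.Run u w u' ∧ R s' u' := by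
  induction hr with
  | nil s => exact fun u hu => ⟨u, .nil u, hu⟩
  | cons hs _ ih =>
    intro u hu
    obtain ⟨v, huv, hv⟩ := h.step _ _ hu _ _ hs
    obtain ⟨u', hvu', hu'⟩ := ih v hv
    exact ⟨u', .cons huv hvu', hu'⟩

theorem IsSimulation.accepts {R : S₁ → S₂ → Prop} (h : T₁.IsSimulation T₂ R) {w : List Lab} :
    T₁.Accepts w → T₂.Accepts w := by
  rintro ⟨s, hs, hr⟩
  obtain ⟨u, hu, hR⟩ := h.run hr _ h.init
  exact ⟨u, h.final _ _ hR hs, hu⟩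

theorem IsSimulation.buchiAccepts {R : S₁ → S₂ → Prop} (h : T₁.IsSimulation T₂ R)
    {w : ℕ → Lab} : T₁.BuchiAccepts w → T₂.BuchiAccepts w := by
  rintro ⟨r, h0, hstep, hfin⟩
  choose g hg hg' using fun (i : ℕ) (u : S₂) (hu : R (r i) u) => h.step _ _ hu _ _ (hstep i)
  let r' : (i : ℕ) → {u : S₂ // R (r i) u} := fun i =>
    Nat.rec ⟨T₂.init, h0 ▸ h.init⟩ (fun i u => ⟨g i u.1 u.2, hg' i u.1 u.2⟩) i
  exact ⟨fun i => (r' i).1, rfl, fun i => hg i (r' i).1 (r' i).2,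
    hfin.mono fun i hi => h.final _ _ (r' i).2 hi⟩

theorem SimEquiv.accepts_iff (h : T₁.SimEquiv T₂) (w : List Lab) :
    T₁.Accepts w ↔ T₂.Accepts w :=
  ⟨h.1.choose_spec.accepts, h.2.choose_spec.accepts⟩

theorem SimEquiv.buchiAccepts_iff (h : T₁.SimEquiv T₂) (w : ℕ → Lab) :
    T₁.BuchiAccepts w ↔ T₂.BuchiAccepts w :=
  ⟨h.1.choose_spec.buchiAccepts, h.2.choose_spec.buchiAccepts⟩

end LTS

/-! ### Formulas and their clauses -/

section Formula

variable {Q X : Type*}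

/-- All guards of the clause hold at `ν`. -/
def Clause.GuardsHold (c : Clause Q X) (ν : X → ℝ≥0) : Prop :=
  ∀ g ∈ c.guards, ν g.1 ∈ g.2.toSet

namespace Formula

theorem sat_iff_dnf {φ : Formula Q X} {C : Config Q X} {ν : X → ℝ≥0} :
    φ.Sat C ν ↔ ∃ c ∈ φ.dnf, c.GuardsHold ν ∧ ∀ m ∈ c.moves, (m.2, resetVal ν m.1) ∈ C := by
  induction φ with
  | tt => simp [Sat, dnf, Clause.GuardsHold]
  | ff => simp [Sat, dnf]
  | guard x I => simp [Sat, dnf, Clause.GuardsHold]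
  | move Y q => simp [Sat, dnf, Clause.GuardsHold]
  | or φ ψ ih₁ ih₂ =>
    simp only [Sat, dnf, List.mem_append, ih₁, ih₂, or_and_right, exists_or]
  | and φ ψ ih₁ ih₂ =>
    simp only [Sat, dnf, ih₁, ih₂, List.mem_flatMap, List.mem_map, Clause.GuardsHold]
    constructor
    · rintro ⟨⟨c, hc, hg, hm⟩, d, hd, hg', hm'⟩
      refine ⟨_, ⟨c, hc, d, hd, rfl⟩, fun g h => ?_, fun m h => ?_⟩
      · exact (List.mem_append.1 h).elim (hg g) (hg' g)
      · exact (List.mem_append.1 h).elim (hm m) (hm' m)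
    · rintro ⟨_, ⟨c, hc, d, hd, rfl⟩, hg, hm⟩
      exact ⟨⟨c, hc, fun g h => hg g (List.mem_append_left _ h),
          fun m h => hm m (List.mem_append_left _ h)⟩,
        d, hd, fun g h => hg g (List.mem_append_right _ h),
          fun m h => hm m (List.mem_append_right _ h)⟩

theorem hasMove_of_mem_dnf {φ : Formula Q X} {c : Clause Q X} (hc : c ∈ φ.dnf) :
    ∀ m ∈ c.moves, φ.HasMove m.1 m.2 := by
  induction φ generalizing c with
  | tt => simp_all [dnf]
  | ff => simp_all [dnf]
  | guard x I => simp_all [dnf]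
  | move Y q => simp_all [dnf, HasMove]
  | or φ ψ ih₁ ih₂ =>
    exact fun m hm => (List.mem_append.1 hc).imp (ih₁ · m hm) (ih₂ · m hm)
  | and φ ψ ih₁ ih₂ =>
    simp only [dnf, List.mem_flatMap, List.mem_map] at hc
    obtain ⟨c, hc, d, hd, rfl⟩ := hc
    exact fun m hm => (List.mem_append.1 hm).imp (ih₁ hc m) (ih₂ hd m)

theorem hasGuard_of_mem_dnf {φ : Formula Q X} {c : Clause Q X} (hc : c ∈ φ.dnf) :
    ∀ g ∈ c.guards, φ.HasGuard g.1 g.2 := by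
  induction φ generalizing c with
  | tt => simp_all [dnf]
  | ff => simp_all [dnf]
  | guard x I => simp_all [dnf, HasGuard]
  | move Y q => simp_all [dnf]
  | or φ ψ ih₁ ih₂ =>
    exact fun m hm => (List.mem_append.1 hc).imp (ih₁ · m hm) (ih₂ · m hm)
  | and φ ψ ih₁ ih₂ =>
    simp only [dnf, List.mem_flatMap, List.mem_map] at hc
    obtain ⟨c, hc, d, hd, rfl⟩ := hc
    exact fun m hm => (List.mem_append.1 hm).imp (ih₁ hc m) (ih₂ hd m)

theorem Sat.exists_isMinModel {φ : Formula Q X} {ν : X → ℝ≥0} {C : Config Q X}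
    (h : φ.Sat C ν) : ∃ C' ⊆ C, φ.IsMinModel C' ν := by
  induction C using Finset.strongInduction with
  | H C ih =>
    by_cases hmin : ∀ C' : Config Q X, C' ⊂ C → ¬ φ.Sat C' ν
    · exact ⟨C, subset_rfl, h, hmin⟩
    · push Not at hmin
      obtain ⟨C', hss, hsat⟩ := hmin
      obtain ⟨D, hD, hDmin⟩ := ih C' hss hsat
      exact ⟨D, hD.trans hss.subset, hDmin⟩

end Formula

/-! ### The order on states and its lifting to configurations -/

variable {ge : Set Q}

theorem StatePrec.refl (s : State Q X) : StatePrec ge s s :=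
  ⟨rfl, fun _ => le_rfl, fun _ => le_rfl⟩

theorem StatePrec.trans {s s' s'' : State Q X} (h : StatePrec ge s s')
    (h' : StatePrec ge s' s'') : StatePrec ge s s'' :=
  ⟨h.1.trans h'.1, fun hs => (h.2.1 hs).trans (h'.2.1 (h.1 ▸ hs)),
    fun hs => (h'.2.2 (h.1 ▸ hs)).trans (h.2.2 hs)⟩

theorem StatePrec.antisymm {s s' : State Q X} (h : StatePrec ge s s')
    (h' : StatePrec ge s' s) : s = s' := by
  refine Prod.ext h.1 ?_
  by_cases hs : s.1 ∈ ge
  · exact le_antisymm (h.2.1 hs) (h'.2.1 (h.1 ▸ hs))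
  · exact le_antisymm (h'.2.2 (h.1 ▸ hs)) (h.2.2 hs)

theorem StatePrec.delay {p : Q} {ν ν' : X → ℝ≥0}
    (h : StatePrec ge (p, ν) (p, ν')) (t : ℝ≥0) :
    StatePrec ge (p, fun x => ν x + t) (p, fun x => ν' x + t) :=
  ⟨rfl, fun hp x => add_le_add_left (h.2.1 hp x) t, fun hp x => add_le_add_left (h.2.2 hp x) t⟩

/-- Every state of `D` lies above some state of `C`. As guards get easier to satisfy upwards,
`D` is then at most as demanding as `C`. -/
def Dominates (ge : Set Q) (C D : Set (State Q X)) : Prop :=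
  ∀ s' ∈ D, ∃ s ∈ C, StatePrec ge s s'

theorem Dominates.of_superset {C D : Set (State Q X)} (h : D ⊆ C) : Dominates ge C D :=
  fun s hs => ⟨s, h hs, .refl s⟩

theorem Dominates.trans {C D E : Set (State Q X)} (h : Dominates ge C D)
    (h' : Dominates ge D E) : Dominates ge C E := fun s hs =>
  let ⟨u, hu, hus⟩ := h' s hs
  let ⟨v, hv, hvu⟩ := h u hu
  ⟨v, hv, hvu.trans hus⟩

theorem red_subset (C : Config Q X) : (red ge C : Set (State Q X)) ⊆ C := by
  classical
  exact fun s hs => (Finset.mem_filter.1 hs).1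

open Classical in
theorem dominates_red (C : Config Q X) :
    Dominates ge (red ge C : Set (State Q X)) (C : Set (State Q X)) := by
  -- Induction on the number of states of `C` below `s`.
  suffices H : ∀ n, ∀ s ∈ C, (C.filter fun u => StatePrec ge u s).card = n →
      ∃ u ∈ red ge C, StatePrec ge u s from fun s hs => H _ s hs rfl
  intro n
  induction n using Nat.strong_induction_on with
  | _ n ih =>
    intro s hs hn
    by_cases h : ∃ u ∈ C, u ≠ s ∧ StatePrec ge u s
    · obtain ⟨u, hu, hne, hus⟩ := h
      have hlt : (C.filter fun v => StatePrec ge v u) ⊂ C.filter fun v => StatePrec ge v s := by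
        refine Finset.ssubset_iff_subset_ne.2 ⟨fun v hv => ?_, fun heq => ?_⟩
        · rw [Finset.mem_filter] at hv ⊢
          exact ⟨hv.1, hv.2.trans hus⟩
        · have : s ∈ C.filter fun v => StatePrec ge v u := by
            rw [heq, Finset.mem_filter]; exact ⟨hs, .refl s⟩
          exact hne (hus.antisymm (Finset.mem_filter.1 this).2)
      obtain ⟨v, hv, hvu⟩ := ih _ (hn ▸ Finset.card_lt_card hlt) u hu rfl
      exact ⟨v, hv, hvu.trans hus⟩
    · exact ⟨s, by unfold red; rw [Finset.mem_filter]; exact ⟨hs, h⟩, .refl s⟩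

theorem resetVal_mono {ν ν' : X → ℝ≥0} (h : ν ≤ ν') (Y : Set X) :
    resetVal ν Y ≤ resetVal ν' Y := by
  intro x
  unfold resetVal
  split_ifs
  exacts [le_rfl, h x]

theorem resetVal_univ (ν : X → ℝ≥0) : resetVal ν Set.univ = fun _ => 0 := by
  ext x; simp [resetVal]

end Formula

/-! ### Steps of unilateral automata -/

namespace ATA

variable {Q Sig X : Type*} {A : ATA Q Sig X} {ge : Set Q}

theorem accConfigs_of_dominates {C D : Config Q X}
    (h : Dominates ge (C : Set (State Q X)) (D : Set (State Q X))) (hC : C ∈ A.accConfigs) :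
    D ∈ A.accConfigs := fun s hs =>
  let ⟨u, hu, hus⟩ := h s hs
  hus.1 ▸ hC u hu

/-- The two states after the same transition, taken at related states. A transition between the
two parts resets all clocks, so that the direction of the order does not matter. -/
theorem IsUnilateral.statePrec_move (hA : A.IsUnilateral ge) {p q : Q} {Y : Set X}
    (hE : A.Edge p Y q) {ν ν' : X → ℝ≥0} (h : StatePrec ge (p, ν) (p, ν')) :
    StatePrec ge (q, resetVal ν Y) (q, resetVal ν' Y) := by
  by_cases hpq : p ∈ ge ↔ q ∈ ge
  · exact ⟨rfl, fun hq => resetVal_mono (h.2.1 (hpq.2 hq)) Y,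
      fun hq => resetVal_mono (h.2.2 fun hp => hq (hpq.1 hp)) Y⟩
  · rw [hA.cross p Y q hE hpq, resetVal_univ, resetVal_univ]
    exact .refl _

theorem IsUnilateral.guardsHold_mono (hA : A.IsUnilateral ge) {p : Q} {a : Sig} {c : Clause Q X}
    (hc : c ∈ (A.δ p a).dnf) {ν ν' : X → ℝ≥0} (h : StatePrec ge (p, ν) (p, ν'))
    (hg : c.GuardsHold ν) : c.GuardsHold ν' := by
  intro g hgc
  have hν := hg g hgc
  have hhas := Formula.hasGuard_of_mem_dnf hc g hgc
  by_cases hp : p ∈ ge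
  · obtain ⟨l, lc, hI⟩ := hA.left p hp a _ _ hhas
    have hle := h.2.1 hp g.1
    rw [hI] at hν ⊢
    cases lc
    · simp only [TimeInterval.toSet, Set.mem_ofPred_eq, Bool.false_eq_true, if_false] at hν ⊢
      exact hν.trans_le hle
    · simp only [TimeInterval.toSet, Set.mem_ofPred_eq, if_true] at hν ⊢
      exact hν.trans hle
  · obtain ⟨u, uc, -, hI⟩ := hA.right p hp a _ _ hhas
    have hle := h.2.2 hp g.1
    rw [hI] at hν ⊢
    refine ⟨by simp, ?_⟩
    have hν₂ := hν.2
    cases uc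
    · simp only [Bool.false_eq_true, if_false] at hν₂ ⊢
      exact hle.trans_lt hν₂
    · simp only [if_true] at hν₂ ⊢
      exact hle.trans hν₂

/-- If, from every state of `D`, some clause of the transition formula has true guards and leads
to states above states of `E`, then `D` has a step into a configuration above `E`: a minimal model
is found among the targets of the clause. -/
theorem exists_step {D : Config Q X} {E : Set (State Q X)} {t : ℝ≥0} {a : Sig}
    (h : ∀ s ∈ D, ∃ c ∈ (A.δ s.1 a).dnf, c.GuardsHold (fun x => s.2 x + t) ∧
      ∀ m ∈ c.moves, ∃ u ∈ E, StatePrec ge u (m.2, resetVal (fun x => s.2 x + t) m.1)) :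
    ∃ D', A.Step D (t, a) D' ∧ Dominates ge E (D' : Set (State Q X)) := by
  classical
  have key : ∀ s : State Q X, ∃ B : Config Q X, s ∈ D →
      B ∈ A.Succ s t a ∧ Dominates ge E (B : Set (State Q X)) := by
    intro s
    by_cases hs : s ∈ D
    · obtain ⟨c, hc, hg, hm⟩ := h s hs
      obtain ⟨B, hB, hBmin⟩ := (Formula.sat_iff_dnf (φ := A.δ s.1 a)
        (C := (c.moves.map fun m => (m.2, resetVal (fun x => s.2 x + t) m.1)).toFinset)
        (ν := fun x => s.2 x + t)).2
        ⟨c, hc, hg, fun m hm => List.mem_toFinset.2 (List.mem_map_of_mem hm)⟩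
        |>.exists_isMinModel
      refine ⟨B, fun _ => ⟨hBmin, fun u hu => ?_⟩⟩
      obtain ⟨m, hmc, rfl⟩ := List.mem_map.1 (List.mem_toFinset.1 (hB hu))
      exact hm m hmc
    · exact ⟨∅, fun h => absurd h hs⟩
  choose f hf using key
  refine ⟨D.biUnion f, ⟨f, fun s hs => (hf s hs).1, by simp⟩, fun u hu => ?_⟩
  obtain ⟨s, hs, hus⟩ := Finset.mem_biUnion.1 (Finset.mem_coe.1 hu)
  exact (hf s hs).2 u hus

/-- Domination is a simulation of `TS(A)` by itself. -/
theorem IsUnilateral.step_of_dominates (hA : A.IsUnilateral ge) {C C' D : Config Q X}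
    {l : ℝ≥0 × Sig} (hCD : Dominates ge (C : Set (State Q X)) (D : Set (State Q X)))
    (hstep : A.Step C l C') :
    ∃ D', A.Step D l D' ∧ Dominates ge (C' : Set (State Q X)) (D' : Set (State Q X)) := by
  obtain ⟨t, a⟩ := l
  obtain ⟨f, hf, hC'⟩ := hstep
  refine exists_step fun s hs => ?_
  obtain ⟨⟨p, ν⟩, hu, hus⟩ := hCD s hs
  obtain ⟨q, ν'⟩ := s
  obtain rfl : p = q := hus.1
  obtain ⟨c, hc, hg, hm⟩ := Formula.sat_iff_dnf.1 (hf _ hu).1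
  refine ⟨c, hc, hA.guardsHold_mono hc (hus.delay t) hg, fun m hmc => ⟨_, ?_,
    hA.statePrec_move ⟨a, Formula.hasMove_of_mem_dnf hc m hmc⟩ (hus.delay t)⟩⟩
  rw [hC']
  exact Set.mem_biUnion (Finset.mem_coe.2 hu) (hm m hmc)

theorem IsUnilateral.simEquiv_redTS (hA : A.IsUnilateral ge) : A.ts.SimEquiv (A.redTS ge) := by
  refine ⟨⟨fun C D => D = red ge C, rfl, ?_, ?_⟩,
    ⟨fun D E => Dominates ge (D : Set (State Q X)) (E : Set (State Q X)),
      dominates_red _, fun _ _ => accConfigs_of_dominates, ?_⟩⟩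
  · rintro C _ rfl
    exact accConfigs_of_dominates (ge := ge) (.of_superset (red_subset C))
  · rintro C _ rfl l C' hC
    exact ⟨_, ⟨C, C', hC, rfl, rfl⟩, rfl⟩
  · rintro _ E hE l _ ⟨C, C', hC, rfl, rfl⟩
    obtain ⟨E', hE', hdom⟩ := hA.step_of_dominates
      (Dominates.trans (.of_superset (red_subset C)) hE) hC
    exact ⟨E', hE', (dominates_red C').trans hdom⟩

theorem IsUnilateral.simEquiv_redRunTS (hA : A.IsUnilateral ge) :
    A.ts.SimEquiv (A.redRunTS ge) := by
  refine ⟨⟨fun C D => Dominates ge (C : Set (State Q X)) (D : Set (State Q X)),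
      .of_superset (red_subset _), fun _ _ => accConfigs_of_dominates, ?_⟩,
    ⟨fun D E => Dominates ge (D : Set (State Q X)) (E : Set (State Q X)),
      dominates_red _, fun _ _ => accConfigs_of_dominates, ?_⟩⟩
  · intro C D hCD l C' hC
    obtain ⟨D', hD', hdom⟩ := hA.step_of_dominates hCD hC
    exact ⟨_, ⟨D', hD', rfl⟩, hdom.trans (.of_superset (red_subset D'))⟩
  · rintro D E hDE l _ ⟨C', hC', rfl⟩
    obtain ⟨E', hE', hdom⟩ := hA.step_of_dominates hDE hC'
    exact ⟨E', hE', (dominates_red C').trans hdom⟩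

end ATA
/-! ### The constructed automaton -/

section Construction

variable {Q Sig X : Type*} [Fintype Q]

theorem isGuardConj_guardConj (ℓ : Loc Q X) (K : List (Q × Clause Q X)) :
    (guardConj ℓ K).IsGuardConj := by
  unfold guardConj
  generalize hL : (K.flatMap fun p =>
    p.2.guards.map fun g => Formula.guard (Q := Loc Q X) (g.1, copyOf ℓ p.1 g.1) g.2) = L
  have hguard : ∀ φ ∈ L, φ.IsGuardConj := by
    intro φ hφ
    rw [← hL] at hφ
    simp only [List.mem_flatMap, List.mem_map] at hφ
    obtain ⟨p, -, g, -, rfl⟩ := hφ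
    trivial
  clear hL
  induction L with
  | nil => trivial
  | cons φ L ih =>
    exact ⟨hguard φ List.mem_cons_self, ih fun ψ hψ => hguard ψ (List.mem_cons_of_mem _ hψ)⟩

theorem isNTA_subsetNTA (A : ATA Q Sig X) (rule : Rule Q X) : (subsetNTA A rule).IsNTA := by
  intro ℓ a
  simp only [subsetNTA]
  induction choices A ℓ a with
  | nil => trivial
  | cons K L ih => exact ⟨isGuardConj_guardConj ℓ K, ih⟩

/-- The clock values that the location `q` reads. -/
def readVal (ℓ : Loc Q X) (ν : X × Copy Q → ℝ≥0) (q : Q) : X → ℝ≥0 :=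
  fun x => ν (x, copyOf ℓ q x)

/-- The set of states of `A` that a state of the constructed automaton stands for. -/
def conf (ℓ : Loc Q X) (ν : X × Copy Q → ℝ≥0) : Set (State Q X) :=
  {s | (ℓ.1 s.1).isSome ∧ s.2 = readVal ℓ ν s.1}

theorem mem_conf {ℓ : Loc Q X} {q : Q} (hq : (ℓ.1 q).isSome) (ν : X × Copy Q → ℝ≥0) :
    (q, readVal ℓ ν q) ∈ conf ℓ ν :=
  ⟨hq, rfl⟩

/-- The state of `A` reached along the transition `e`. -/
noncomputable def Arrow.target (ℓ : Loc Q X) (ν : X × Copy Q → ℝ≥0) (e : Arrow Q X) :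
    State Q X :=
  (e.tgt, resetVal (readVal ℓ ν e.src) e.reset)

theorem guardConj_sat (ℓ : Loc Q X) (K : List (Q × Clause Q X))
    (C : Config (Loc Q X) (X × Copy Q)) (ν : X × Copy Q → ℝ≥0) :
    (guardConj ℓ K).Sat C ν ↔ ∀ p ∈ K, p.2.GuardsHold (readVal ℓ ν p.1) := by
  have hfold : ∀ L : List (Formula (Loc Q X) (X × Copy Q)),
      (L.foldr Formula.and Formula.tt).Sat C ν ↔ ∀ φ ∈ L, φ.Sat C ν := by
    intro L
    induction L with
    | nil => simp [Formula.Sat]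
    | cons φ L ih => simp [Formula.Sat, ih]
  rw [guardConj, hfold]
  simp only [List.mem_flatMap, List.mem_map, Clause.GuardsHold, readVal]
  constructor
  · exact fun h p hp g hg => h _ ⟨p, hp, g, hg, rfl⟩
  · rintro h _ ⟨p, hp, g, hg, rfl⟩
    exact h p hp g hg

theorem subsetNTA_sat (A : ATA Q Sig X) (rule : Rule Q X) (ℓ : Loc Q X) (a : Sig)
    (C : Config (Loc Q X) (X × Copy Q)) (ν : X × Copy Q → ℝ≥0) :
    ((subsetNTA A rule).δ ℓ a).Sat C ν ↔ ∃ K ∈ choices A ℓ a,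
      (∀ p ∈ K, p.2.GuardsHold (readVal ℓ ν p.1)) ∧
        (nextLoc rule ℓ K, resetVal ν (resetCopies rule ℓ K)) ∈ C := by
  simp only [subsetNTA]
  induction choices A ℓ a with
  | nil => simp [Formula.Sat]
  | cons K L ih =>
    simp only [List.map_cons, List.foldr_cons, Formula.Sat, ih, guardConj_sat,
      List.exists_mem_cons_iff, and_comm]

theorem subsetNTA_succ (A : ATA Q Sig X) (rule : Rule Q X) (ℓ : Loc Q X)
    (ν : X × Copy Q → ℝ≥0) (t : ℝ≥0) (a : Sig) (C : Config (Loc Q X) (X × Copy Q)) :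
    C ∈ (subsetNTA A rule).Succ (ℓ, ν) t a ↔ ∃ K ∈ choices A ℓ a,
      (∀ p ∈ K, p.2.GuardsHold (readVal ℓ (fun z => ν z + t) p.1)) ∧
        C = {(nextLoc rule ℓ K, resetVal (fun z => ν z + t) (resetCopies rule ℓ K))} := by
  simp only [ATA.Succ, Formula.IsMinModel, subsetNTA_sat, Set.mem_ofPred_eq]
  constructor
  · rintro ⟨⟨K, hK, hg, hC⟩, hmin⟩
    refine ⟨K, hK, hg, ?_⟩
    by_contra hne
    exact hmin _ (Finset.ssubset_iff_subset_ne.2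
      ⟨Finset.singleton_subset_iff.2 hC, fun h => hne h.symm⟩)
      ⟨K, hK, hg, Finset.mem_singleton_self _⟩
  · rintro ⟨K, hK, hg, rfl⟩
    refine ⟨⟨K, hK, hg, Finset.mem_singleton_self _⟩, ?_⟩
    rintro C' hC' ⟨K', -, -, h⟩
    rw [Finset.ssubset_singleton_iff.1 hC'] at h
    simp at h

theorem step_singleton {Q X : Type*} (B : ATA Q Sig X) (s : State Q X) (l : ℝ≥0 × Sig)
    (C : Config Q X) : B.Step {s} l C ↔ C ∈ B.Succ s l.1 l.2 := by
  constructor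
  · rintro ⟨f, hf, hC⟩
    have : C = f s := by
      rw [← Finset.coe_inj, hC]; simp
    exact this ▸ hf s (Finset.mem_singleton_self s)
  · exact fun h => ⟨fun _ => C, by simpa using h, by simp⟩

/-! ### Choices of clauses -/

section Choices

variable {A : ATA Q Sig X} {rule : Rule Q X} {ℓ : Loc Q X} {a : Sig} {K : List (Q × Clause Q X)}

theorem mem_dnf_of_mem_choices (hK : K ∈ choices A ℓ a) :
    ∀ p ∈ K, (ℓ.1 p.1).isSome ∧ p.2 ∈ (A.δ p.1 a).dnf := by
  rw [choices, List.mem_sections, List.forall₂_map_right_iff] at hK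
  intro p hp
  obtain ⟨i, hi, rfl⟩ := List.getElem_of_mem hp
  have h := List.Forall₂.get hK hi (hK.length_eq ▸ hi)
  obtain ⟨c, hc, heq⟩ := List.mem_map.1 h
  simp only [List.get_eq_getElem] at heq
  rw [← heq]
  refine ⟨?_, hc⟩
  have := List.getElem_mem (hK.length_eq ▸ hi :
    i < ((Finset.univ.filter fun q => (ℓ.1 q).isSome).toList).length)
  exact (Finset.mem_filter.1 (Finset.mem_toList.1 this)).2

theorem exists_clause_of_mem_choices (hK : K ∈ choices A ℓ a) {q : Q} (hq : (ℓ.1 q).isSome) :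
    ∃ c, (q, c) ∈ K := by
  rw [choices, List.mem_sections, List.forall₂_map_right_iff] at hK
  have hmem : q ∈ (Finset.univ.filter fun q => (ℓ.1 q).isSome).toList := by simpa using hq
  obtain ⟨i, hi, hiq⟩ := List.getElem_of_mem hmem
  have h := List.Forall₂.get hK (hK.length_eq.symm ▸ hi) hi
  obtain ⟨c, -, heq⟩ := List.mem_map.1 h
  simp only [List.get_eq_getElem, hiq] at heq
  exact ⟨c, heq ▸ List.getElem_mem _⟩

theorem exists_mem_choices {c : Q → Clause Q X}
    (hc : ∀ q, (ℓ.1 q).isSome → c q ∈ (A.δ q a).dnf) :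
    ∃ K ∈ choices A ℓ a, ∀ p ∈ K, (ℓ.1 p.1).isSome ∧ p.2 = c p.1 := by
  refine ⟨((Finset.univ.filter fun q => (ℓ.1 q).isSome).toList).map fun q => (q, c q), ?_, ?_⟩
  · rw [choices, List.mem_sections, List.forall₂_map_right_iff, List.forall₂_map_left_iff,
      List.forall₂_same]
    exact fun q hq => List.mem_map_of_mem (hc q (by simpa using hq))
  · intro p hp
    obtain ⟨q, hq, rfl⟩ := List.mem_map.1 hp
    exact ⟨by simpa using hq, rfl⟩

theorem mem_arrows {Q X : Type*} {K : List (Q × Clause Q X)} {e : Arrow Q X} :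
    e ∈ arrows K ↔ ∃ p ∈ K, ∃ m ∈ p.2.moves, ⟨p.1, m.1, m.2⟩ = e := by
  simp [arrows]

theorem edge_of_mem_arrows (hK : K ∈ choices A ℓ a) {e : Arrow Q X} (he : e ∈ arrows K) :
    (ℓ.1 e.src).isSome ∧ A.Edge e.src e.reset e.tgt := by
  obtain ⟨p, hp, m, hm, rfl⟩ := mem_arrows.1 he
  obtain ⟨h, hc⟩ := mem_dnf_of_mem_choices hK p hp
  exact ⟨h, a, Formula.hasMove_of_mem_dnf hc m hm⟩

/-! ### The clock copies of the successor location -/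

theorem kept_spec {q : Q} {e : Arrow Q X} (h : kept rule ℓ K q = some e) :
    e ∈ arrows K ∧ e.tgt = q ∧ ∀ e' ∈ arrows K, e'.tgt = q → rule ℓ e e' := by
  have := List.find?_some h
  simp only [decide_eq_true_eq] at this
  exact ⟨List.mem_of_find?_eq_some h, this⟩

theorem exists_kept {e : Arrow Q X} (he : e ∈ arrows K)
    (hbest : ∀ e' ∈ arrows K, e'.tgt = e.tgt → rule ℓ e e') :
    ∃ e₀, kept rule ℓ K e.tgt = some e₀ := by
  rw [← Option.isSome_iff_exists, kept, List.find?_isSome]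
  exact ⟨e, he, by simpa using hbest⟩

theorem nextLoc_isSome {q : Q} :
    ((nextLoc rule ℓ K).1 q).isSome ↔ ∃ e, kept rule ℓ K q = some e := by
  simp [nextLoc, Option.isSome_iff_exists]

theorem copyOf_nextLoc {q : Q} {e : Arrow Q X} (h : kept rule ℓ K q = some e) (x : X) :
    copyOf (nextLoc rule ℓ K) q x = newCopy rule ℓ K e x := by
  simp [copyOf, nextLoc, h]

/-- Every copy that is read by a present location is active. -/
def Active (ℓ : Loc Q X) : Prop :=
  ∀ q, (ℓ.1 q).isSome → ∀ x, copyOf ℓ q x ∈ (ℓ.2 x).1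

theorem mem_stay {x : X} {w : Copy Q} : w ∈ stay rule ℓ K x ↔ w ∈ (ℓ.2 x).1 ∧
    ∃ q e, kept rule ℓ K q = some e ∧ x ∉ e.reset ∧ copyOf ℓ e.src x = w := by
  simp [stay]

theorem mem_stay_of_kept (hact : Active ℓ) (hK : K ∈ choices A ℓ a) {q : Q} {e : Arrow Q X}
    (h : kept rule ℓ K q = some e) {x : X} (hx : x ∉ e.reset) :
    copyOf ℓ e.src x ∈ stay rule ℓ K x :=
  mem_stay.2 ⟨hact _ (edge_of_mem_arrows hK (kept_spec h).1).1 x, q, e, h, hx, rfl⟩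

/-- A location entered by a reset of `x` does not contribute to the inherited copies of `x`, hence
these are fewer than `|Q|` and a fresh copy exists. -/
theorem fresh_notMem_stay {q : Q} {e : Arrow Q X} (h : kept rule ℓ K q = some e) {x : X}
    (hx : x ∈ e.reset) (q' : Q) : fresh rule ℓ K q' x ∉ stay rule ℓ K x := by
  classical
  have hsome : ∃ w, w ∉ stay rule ℓ K x := by
    by_contra hall
    push Not at hall
    -- Every copy would be inherited along the transition kept for some location other than `q`.
    have hsub : (Finset.univ : Finset (Copy Q)) ⊆ (Finset.univ.erase q).image fun r =>
        ((kept rule ℓ K r).map fun e => copyOf ℓ e.src x).getD (zeroCopy q) := by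
      intro w _
      obtain ⟨-, r, e', he', hx', rfl⟩ := mem_stay.1 (hall w)
      refine Finset.mem_image.2 ⟨r, Finset.mem_erase.2 ⟨?_, Finset.mem_univ _⟩, by simp [he']⟩
      rintro rfl
      rw [h, Option.some.injEq] at he'
      exact hx' (he' ▸ hx)
    have h₁ := (Finset.card_le_card hsub).trans Finset.card_image_le
    rw [Finset.card_erase_of_mem (Finset.mem_univ q), Finset.card_univ, Finset.card_univ,
      Fintype.card_fin] at h₁
    have h₂ : 0 < Fintype.card Q := Fintype.card_pos_iff.2 ⟨q⟩
    omega
  obtain ⟨w, hw⟩ := hsome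
  have : ((List.finRange (Fintype.card Q)).find? fun w => w ∉ stay rule ℓ K x).isSome := by
    rw [List.find?_isSome]
    exact ⟨w, List.mem_finRange w, by simpa using hw⟩
  obtain ⟨v, hv⟩ := Option.isSome_iff_exists.1 this
  have hv' := List.find?_some hv
  rw [fresh, hv]
  simpa using hv'

/-- A copy that is inherited without reset by a kept transition is not reset by another one. -/
theorem notMem_resetCopies (hact : Active ℓ) (hK : K ∈ choices A ℓ a) {q : Q} {e : Arrow Q X}
    (h : kept rule ℓ K q = some e) {x : X} (hx : x ∉ e.reset) :
    (x, copyOf ℓ e.src x) ∉ resetCopies rule ℓ K := by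
  rintro ⟨q', e', h', hx', heq⟩
  simp only at hx' heq
  have he := (kept_spec h).1
  rw [newCopy, if_neg (not_not.2 hx')] at heq
  split_ifs at heq with hall hsame
  · exact hx (hall e he)
  · obtain ⟨p, hp, m, hm, rfl⟩ := mem_arrows.1 he
    exact hx (hsame p hp heq.symm m hm)
  · exact fresh_notMem_stay h' hx' _ (heq ▸ mem_stay_of_kept hact hK h hx)

/-- After the step, the target of a kept transition reads the values prescribed by `A`. -/
theorem readVal_nextLoc (hact : Active ℓ) (hK : K ∈ choices A ℓ a) {q : Q} {e : Arrow Q X}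
    (h : kept rule ℓ K q = some e) (ν : X × Copy Q → ℝ≥0) :
    (q, readVal (nextLoc rule ℓ K) (resetVal ν (resetCopies rule ℓ K)) q) = e.target ℓ ν := by
  refine Prod.ext (kept_spec h).2.1.symm (funext fun x => ?_)
  simp only [Arrow.target, readVal, copyOf_nextLoc h]
  by_cases hx : x ∈ e.reset
  · have hmem : (x, newCopy rule ℓ K e x) ∈ resetCopies rule ℓ K := ⟨q, e, h, hx, rfl⟩
    rw [resetVal, resetVal, if_pos hmem, if_pos hx]
  · have hnew : newCopy rule ℓ K e x = copyOf ℓ e.src x := if_pos hx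
    rw [resetVal, resetVal, hnew, if_neg (notMem_resetCopies hact hK h hx), if_neg hx,
      readVal]

theorem mem_nextAct {x : X} {w : Copy Q} : w ∈ (nextAct rule ℓ K x).1 ↔
    w ∈ stay rule ℓ K x ∨ (x, w) ∈ resetCopies rule ℓ K := by
  simp only [nextAct, List.mem_append, List.mem_filter, List.mem_finRange, true_and,
    decide_eq_true_eq]
  tauto

theorem Active.nextLoc (hact : Active ℓ) (hK : K ∈ choices A ℓ a) :
    Active (nextLoc rule ℓ K) := by
  intro q hq x
  obtain ⟨e, he⟩ := nextLoc_isSome.1 hq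
  rw [copyOf_nextLoc he]
  refine mem_nextAct.2 ?_
  by_cases hx : x ∈ e.reset
  · exact .inr ⟨q, e, he, hx, rfl⟩
  · have hnew : newCopy rule ℓ K e x = copyOf ℓ e.src x := if_pos hx
    exact .inl (hnew ▸ mem_stay_of_kept hact hK he hx)

end Choices

/-! ### Simulation by means of an invariant -/

/-- An invariant of the states of the constructed automaton which guarantees that the kept
transitions lead to the lowest among the states reached with the same location. -/
structure SelectsLowest (A : ATA Q Sig X) (ge : Set Q) (rule : Rule Q X)
    (P : Loc Q X → (X × Copy Q → ℝ≥0) → Prop) : Prop where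
  init : P (subsetNTA A rule).q₀ fun _ => 0
  delay : ∀ ℓ ν (t : ℝ≥0), P ℓ ν → P ℓ fun z => ν z + t
  next : ∀ ℓ ν a, ∀ K ∈ choices A ℓ a, Active ℓ → P ℓ ν →
    P (nextLoc rule ℓ K) (resetVal ν (resetCopies rule ℓ K))
  lowest : ∀ ℓ ν a, ∀ K ∈ choices A ℓ a, Active ℓ → P ℓ ν → ∀ e ∈ arrows K,
    ∃ e₀, kept rule ℓ K e.tgt = some e₀ ∧ StatePrec ge (e₀.target ℓ ν) (e.target ℓ ν)

variable {A : ATA Q Sig X} {ge : Set Q} {rule : Rule Q X}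

theorem active_init : Active (subsetNTA A rule).q₀ := by
  intro q hq x
  by_cases h : q = A.q₀
  · simp [subsetNTA, copyOf, h]
  · simp [subsetNTA, h] at hq

theorem conf_init :
    conf (subsetNTA A rule).q₀ (fun _ => 0) = ((A.ts.init : Config Q X) : Set (State Q X)) := by
  ext ⟨q, ν⟩
  by_cases h : q = A.q₀ <;> simp [conf, subsetNTA, ATA.ts, h, readVal, funext_iff]

/-- A step of `A` from a configuration above which the state `(ℓ, ν)` lies is matched by choosing,
for each present location, the clause used by some state below. Any rule would do here. -/
theorem exists_step_subsetNTA (hA : A.IsUnilateral ge) {ℓ : Loc Q X} {ν : X × Copy Q → ℝ≥0}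
    (hact : Active ℓ) {C C' : Config Q X} {t : ℝ≥0} {a : Sig}
    (hdom : Dominates ge (C : Set (State Q X)) (conf ℓ ν)) (hstep : A.Step C (t, a) C') :
    ∃ K ∈ choices A ℓ a, (∀ p ∈ K, p.2.GuardsHold (readVal ℓ (fun z => ν z + t) p.1)) ∧
      Dominates ge (C' : Set (State Q X)) (conf (nextLoc rule ℓ K)
        (resetVal (fun z => ν z + t) (resetCopies rule ℓ K))) := by
  obtain ⟨f, hf, hC'⟩ := hstep
  have key : ∀ q, ∃ c : Clause Q X, (ℓ.1 q).isSome → c ∈ (A.δ q a).dnf ∧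
      c.GuardsHold (readVal ℓ (fun z => ν z + t) q) ∧
      ∀ m ∈ c.moves, ∃ u ∈ C',
        StatePrec ge u (m.2, resetVal (readVal ℓ (fun z => ν z + t) q) m.1) := by
    intro q
    by_cases hq : (ℓ.1 q).isSome
    · obtain ⟨⟨p, μ⟩, hs, hsq⟩ := hdom _ (mem_conf hq ν)
      obtain rfl : p = q := hsq.1
      obtain ⟨c, hc, hg, hm⟩ := Formula.sat_iff_dnf.1 (hf _ hs).1
      refine ⟨c, fun _ => ⟨hc, hA.guardsHold_mono hc (hsq.delay t) hg, fun m hmc => ⟨_, ?_,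
        hA.statePrec_move ⟨a, Formula.hasMove_of_mem_dnf hc m hmc⟩ (hsq.delay t)⟩⟩⟩
      rw [← Finset.mem_coe, hC']
      exact Set.mem_biUnion (Finset.mem_coe.2 hs) (hm m hmc)
    · exact ⟨⟨[], []⟩, fun h => absurd h hq⟩
  choose c hc using key
  obtain ⟨K, hK, hKc⟩ := exists_mem_choices (A := A) (a := a) fun q hq => (hc q hq).1
  refine ⟨K, hK, fun p hp => ?_, ?_⟩
  · rw [(hKc p hp).2]
    exact (hc _ (hKc p hp).1).2.1
  · rintro ⟨q, μ⟩ ⟨hq, hμ⟩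
    simp only at hq hμ
    obtain ⟨e, he⟩ := nextLoc_isSome.1 hq
    rw [hμ, readVal_nextLoc hact hK he]
    obtain ⟨p, hp, m, hm, rfl⟩ := mem_arrows.1 (kept_spec he).1
    rw [(hKc p hp).2] at hm
    exact (hc _ (hKc p hp).1).2.2 m hm

/-- A step of the constructed automaton is matched from every configuration above. -/
theorem SelectsLowest.exists_step {P : Loc Q X → (X × Copy Q → ℝ≥0) → Prop}
    (hP : SelectsLowest A ge rule P) (hA : A.IsUnilateral ge) {ℓ : Loc Q X}
    {ν : X × Copy Q → ℝ≥0} (hact : Active ℓ) (hPν : P ℓ ν) {C : Config Q X} {t : ℝ≥0} {a : Sig}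
    (hdom : Dominates ge (conf ℓ ν) (C : Set (State Q X))) {K : List (Q × Clause Q X)}
    (hK : K ∈ choices A ℓ a)
    (hg : ∀ p ∈ K, p.2.GuardsHold (readVal ℓ (fun z => ν z + t) p.1)) :
    ∃ C', A.Step C (t, a) C' ∧ Dominates ge (conf (nextLoc rule ℓ K)
        (resetVal (fun z => ν z + t) (resetCopies rule ℓ K))) (C' : Set (State Q X)) := by
  refine ATA.exists_step ?_
  rintro ⟨q, μ'⟩ hs
  obtain ⟨⟨p, μ⟩, ⟨hp, hμ⟩, hus⟩ := hdom _ hs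
  obtain rfl : p = q := hus.1
  simp only at hp hμ
  subst hμ
  obtain ⟨c, hcK⟩ := exists_clause_of_mem_choices hK hp
  have hc := (mem_dnf_of_mem_choices hK _ hcK).2
  refine ⟨c, hc, hA.guardsHold_mono hc (hus.delay t) (hg _ hcK), fun m hm => ?_⟩
  have he := mem_arrows.2 ⟨_, hcK, m, hm, rfl⟩
  obtain ⟨e₀, he₀, hlow⟩ := hP.lowest ℓ _ a K hK hact (hP.delay _ _ t hPν) _ he
  refine ⟨_, mem_conf (nextLoc_isSome.2 ⟨e₀, he₀⟩) _, ?_⟩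
  simp only at he₀
  rw [readVal_nextLoc hact hK he₀]
  exact hlow.trans
    (hA.statePrec_move ⟨a, Formula.hasMove_of_mem_dnf hc m hm⟩ (hus.delay t))

theorem SelectsLowest.simEquiv {P : Loc Q X → (X × Copy Q → ℝ≥0) → Prop}
    (hP : SelectsLowest A ge rule P) (hA : A.IsUnilateral ge) :
    A.ts.SimEquiv (subsetNTA A rule).ts := by
  refine ⟨⟨fun C S => ∃ ℓ ν, S = {(ℓ, ν)} ∧ Active ℓ ∧
      Dominates ge (C : Set (State Q X)) (conf ℓ ν), ?_, ?_, ?_⟩,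
    ⟨fun S C => ∃ ℓ ν, S = {(ℓ, ν)} ∧ Active ℓ ∧ P ℓ ν ∧
      Dominates ge (conf ℓ ν) (C : Set (State Q X)), ?_, ?_, ?_⟩⟩
  · exact ⟨_, _, rfl, active_init, .of_superset conf_init.subset⟩
  · rintro C _ ⟨ℓ, ν, rfl, -, hdom⟩ hC s hs q hq
    rw [Finset.mem_singleton.1 hs] at hq
    obtain ⟨u, hu, hus⟩ := hdom _ (mem_conf hq ν)
    have hacc := hC u hu
    rwa [hus.1] at hacc
  · rintro C _ ⟨ℓ, ν, rfl, hact, hdom⟩ ⟨t, a⟩ C' hC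
    obtain ⟨K, hK, hg, hdom'⟩ := exists_step_subsetNTA (rule := rule) hA hact hdom hC
    exact ⟨_, (step_singleton _ _ _ _).2 ((subsetNTA_succ _ _ _ _ _ _ _).2 ⟨K, hK, hg, rfl⟩),
      _, _, rfl, hact.nextLoc hK, hdom'⟩
  · exact ⟨_, _, rfl, active_init, hP.init, .of_superset conf_init.superset⟩
  · rintro _ C ⟨ℓ, ν, rfl, -, -, hdom⟩ hfin s hs
    obtain ⟨u, hu, hus⟩ := hdom s hs
    exact hus.1 ▸ hfin _ (Finset.mem_singleton_self _) u.1 hu.1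
  · rintro _ C ⟨ℓ, ν, rfl, hact, hPν, hdom⟩ ⟨t, a⟩ S' hS
    obtain ⟨K, hK, hg, rfl⟩ :=
      (subsetNTA_succ _ _ _ _ _ _ _).1 ((step_singleton _ _ _ _).1 hS)
    obtain ⟨C', hC', hdom'⟩ := hP.exists_step hA hact hPν hdom hK hg
    exact ⟨C', hC', _, _, rfl, hact.nextLoc hK,
      hP.next _ _ a K hK hact (hP.delay _ _ t hPν), hdom'⟩

/-! ### The invariant of very weak automata -/

/-- `Path A p Y q`: some path of transitions leads from `p` to `q` and resets in total the clocks
in `Y`. -/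
inductive ATA.Path {Q Sig X : Type*} (A : ATA Q Sig X) : Q → Set X → Q → Prop
  | refl (p : Q) : Path A p ∅ p
  | tail {p q r : Q} {Y Z : Set X} : Path A p Y q → A.Edge q Z r → Path A p (Y ∪ Z) r

theorem ATA.Path.head {Q Sig X : Type*} {A : ATA Q Sig X} {p q r : Q} {Y Z : Set X}
    (h : A.Path q Y r) (hE : A.Edge p Z q) : A.Path p (Z ∪ Y) r := by
  induction h with
  | refl => simpa [Set.union_comm] using (ATA.Path.refl p).tail hE
  | tail _ hE' ih => exact Set.union_assoc _ _ _ ▸ ih.tail hE'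

/-- As self-loops reset nothing, a path between distinct locations may be taken to end with a
transition from the parent. -/
theorem ATA.IsVeryWeak.path_cases {Q Sig X : Type*} {A : ATA Q Sig X} (hA : A.IsVeryWeak)
    {p q : Q} {Y : Set X} (h : A.Path p Y q) : p = q ∨
      ∃ b Z Y', b ≠ q ∧ A.Edge b Z q ∧ A.Path p Y' b ∧ Y = Y' ∪ Z := by
  induction h with
  | refl => exact .inl rfl
  | @tail q r Y Z hpath hE ih =>
    by_cases hqr : q = r
    · subst hqr
      rw [hA.loop q Z hE, Set.union_empty]
      exact ih
    · exact .inr ⟨q, Z, Y, hqr, hE, hpath, rfl⟩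

/-- A location reads values at least as large as those obtained by entering it anew from one of
its present ancestors. -/
def OlderThanAncestors (A : ATA Q Sig X) (ℓ : Loc Q X) (ν : X × Copy Q → ℝ≥0) : Prop :=
  ∀ p q Y, (ℓ.1 p).isSome → (ℓ.1 q).isSome → A.Path p Y q →
    resetVal (readVal ℓ ν p) Y ≤ readVal ℓ ν q

theorem resetVal_union (ν : X → ℝ≥0) (Y Z : Set X) :
    resetVal ν (Y ∪ Z) = resetVal (resetVal ν Y) Z := by
  ext x
  by_cases hY : x ∈ Y <;> by_cases hZ : x ∈ Z <;> simp [resetVal, hY, hZ]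

theorem resetVal_empty (ν : X → ℝ≥0) : resetVal ν ∅ = ν := by
  ext x; simp [resetVal]

theorem resetVal_le (ν : X → ℝ≥0) (Y : Set X) : resetVal ν Y ≤ ν := by
  intro x
  unfold resetVal
  split_ifs
  exacts [zero_le, le_rfl]

theorem OlderThanAncestors.next (hA : A.IsVeryWeak) {ℓ : Loc Q X} {ν : X × Copy Q → ℝ≥0}
    {a : Sig} {K : List (Q × Clause Q X)} (hK : K ∈ choices A ℓ a) (hact : Active ℓ)
    (h : OlderThanAncestors A ℓ ν) :
    OlderThanAncestors A (nextLoc rule ℓ K) (resetVal ν (resetCopies rule ℓ K)) := by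
  intro p q Y hp hq hpath
  by_cases hpq : p = q
  · exact hpq ▸ resetVal_le _ _
  obtain ⟨e, he⟩ := nextLoc_isSome.1 hp
  obtain ⟨e', he'⟩ := nextLoc_isSome.1 hq
  have hp' := congrArg Prod.snd (readVal_nextLoc hact hK he ν)
  have hq' := congrArg Prod.snd (readVal_nextLoc hact hK he' ν)
  simp only [Arrow.target] at hp' hq'
  rw [hp', hq', ← resetVal_union]
  obtain ⟨hsrc, hE⟩ := edge_of_mem_arrows hK (kept_spec he).1
  obtain ⟨hsrc', hE'⟩ := edge_of_mem_arrows hK (kept_spec he').1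
  rw [(kept_spec he).2.1] at hE
  rw [(kept_spec he').2.1] at hE'
  by_cases hloop : e'.src = q
  · rw [hloop] at hE' hsrc' ⊢
    rw [hA.loop q _ hE', resetVal_empty]
    exact h _ _ _ hsrc hsrc' (hpath.head hE)
  · -- The location `q` is entered anew from its parent, which the given path passes.
    obtain rfl | ⟨b, Z, Y', hb, hbE, hbpath, rfl⟩ := hA.path_cases hpath
    · exact absurd rfl hpq
    obtain rfl := hA.parent q _ _ _ _ hb hloop hbE hE'
    rw [hA.resets _ _ _ _ hbE hE', ← Set.union_assoc, resetVal_union]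
    exact resetVal_mono (h _ _ _ hsrc hsrc' (hbpath.head hE)) _

theorem selectsLowest_selfLoopRule (hA : A.IsVeryWeak) :
    SelectsLowest A ge (selfLoopRule ge) (OlderThanAncestors A) where
  init p q Y _ _ _ x := by simp [readVal, resetVal]
  delay ℓ ν t h p q Y hp hq hpath x := by
    have := h p q Y hp hq hpath x
    by_cases hx : x ∈ Y
    · simp [resetVal, hx]
    · simp only [resetVal, hx, if_false, readVal] at this ⊢
      exact add_le_add_left this t
  next ℓ ν a K hK hact h := h.next hA hK hact
  lowest ℓ ν a K hK hact h e he := by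
    have hkept : ∃ e₀, kept (selfLoopRule ge) ℓ K e.tgt = some e₀ := by
      -- The preference only depends on whether a transition is a self-loop.
      by_cases hex : ∃ e' ∈ arrows K, e'.tgt = e.tgt ∧ (e.tgt ∈ ge ↔ e'.src ≠ e'.tgt)
      · obtain ⟨e', he', htgt, hiff⟩ := hex
        rw [← htgt] at hiff ⊢
        refine exists_kept he' fun e'' he'' htgt' => ⟨fun hge hl => ?_, fun hge hl => ?_⟩
        · exact absurd hl (hiff.1 hge)
        · by_contra hne
          exact hge (hiff.2 hne)
      · push Not at hex
        refine exists_kept he fun e' he' htgt => ?_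
        have h₁ := hex e he rfl
        have h₂ := hex e' he' htgt
        unfold selfLoopRule
        tauto
    obtain ⟨e₀, he₀⟩ := hkept
    refine ⟨e₀, he₀, ?_⟩
    obtain ⟨hmem, htgt, hbest⟩ := kept_spec he₀
    have hrule := hbest e he rfl
    obtain ⟨hsrc, hE⟩ := edge_of_mem_arrows hK he
    obtain ⟨hsrc₀, hE₀⟩ := edge_of_mem_arrows hK hmem
    obtain ⟨p, Y, q⟩ := e
    obtain ⟨p₀, Y₀, q₀⟩ := e₀
    obtain rfl : q₀ = q := htgt
    simp only [selfLoopRule] at hrule hsrc hE hsrc₀ hE₀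
    -- Entering from an ancestor compares with staying by the invariant.
    have hcmp : ∀ r Z, (ℓ.1 r).isSome → (ℓ.1 q₀).isSome → A.Edge r Z q₀ →
        resetVal (readVal ℓ ν r) Z ≤ readVal ℓ ν q₀ := fun r Z hr hq hrE =>
      h r q₀ Z hr hq (Set.empty_union Z ▸ (ATA.Path.refl r).tail hrE)
    have hsame : p₀ = p → StatePrec ge
        (Arrow.target ℓ ν ⟨p₀, Y₀, q₀⟩) (Arrow.target ℓ ν ⟨p, Y, q₀⟩) := by
      rintro rfl
      rw [hA.resets _ _ _ _ hE hE₀]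
      exact .refl _
    by_cases hl : p = q₀ <;> by_cases hl₀ : p₀ = q₀
    · exact hsame (hl₀.trans hl.symm)
    · subst hl
      refine ⟨rfl, fun _ => ?_, fun hge => absurd (hrule.2 hge rfl) hl₀⟩
      simp only [Arrow.target]
      rw [hA.loop _ _ hE, resetVal_empty]
      exact hcmp p₀ Y₀ hsrc₀ hsrc hE₀
    · subst hl₀
      refine ⟨rfl, fun hge => absurd (hrule.1 hge rfl) hl, fun _ => ?_⟩
      simp only [Arrow.target]
      rw [hA.loop _ _ hE₀, resetVal_empty]
      exact hcmp p Y hsrc hsrc₀ hE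
    · exact hsame (hA.parent _ _ _ _ _ hl₀ hl hE₀ hE)

/-! ### The invariant of one-clock automata -/

/-- The active copies of each clock are listed in the order of decreasing values. -/
def SortedByAge (ℓ : Loc Q X) (ν : X × Copy Q → ℝ≥0) : Prop :=
  ∀ x, (ℓ.2 x).1.Pairwise fun w w' => ν (x, w') ≤ ν (x, w)

theorem SortedByAge.next {ℓ : Loc Q X} {ν : X × Copy Q → ℝ≥0} (h : SortedByAge ℓ ν)
    (K : List (Q × Clause Q X)) :
    SortedByAge (nextLoc rule ℓ K) (resetVal ν (resetCopies rule ℓ K)) := by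
  intro x
  simp only [nextLoc, nextAct]
  have hzero : ∀ w, (x, w) ∈ resetCopies rule ℓ K →
      resetVal ν (resetCopies rule ℓ K) (x, w) = 0 := fun w hw => if_pos hw
  rw [List.pairwise_append]
  refine ⟨?_, ?_, ?_⟩
  · refine List.Pairwise.imp_of_mem ?_ (((h x).filter _).filter _)
    intro w w' hw hw' hle
    have h₁ : (x, w) ∉ resetCopies rule ℓ K := by simpa using (List.mem_filter.1 hw).2
    exact (resetVal_le ν _ _).trans (hle.trans_eq (if_neg h₁).symm)
  · refine List.Pairwise.imp_of_mem (R := fun _ _ => True) (fun {w w'} _ hw' _ => ?_)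
      (List.pairwise_of_forall fun _ _ => trivial)
    rw [hzero w' (by simpa using hw')]
    exact zero_le
  · intro w _ w' hw'
    rw [hzero w' (by simpa using hw')]
    exact zero_le

/-- Along a less recent transition the target reads a larger value. -/
theorem SortedByAge.resetVal_le_of_recency_le {ℓ : Loc Q X} {ν : X × Copy Q → ℝ≥0}
    (h : SortedByAge ℓ ν) (hact : Active ℓ) {e e' : Arrow Q X} (hsrc : (ℓ.1 e.src).isSome)
    (hsrc' : (ℓ.1 e'.src).isSome) {x : X} (hle : recency ℓ e x ≤ recency ℓ e' x) :
    resetVal (readVal ℓ ν e'.src) e'.reset x ≤ resetVal (readVal ℓ ν e.src) e.reset x := by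
  unfold recency at hle
  unfold resetVal readVal
  by_cases hx' : x ∈ e'.reset
  · rw [if_pos hx']
    exact zero_le
  by_cases hx : x ∈ e.reset
  · rw [if_pos hx, if_neg hx', top_le_iff] at hle
    exact absurd hle (ENat.natCast_ne_top _)
  rw [if_neg hx, if_neg hx', Nat.cast_le] at hle
  rw [if_neg hx, if_neg hx']
  have hi := List.idxOf_lt_length_of_mem (hact _ hsrc x)
  have hi' := List.idxOf_lt_length_of_mem (hact _ hsrc' x)
  obtain hlt | heq := hle.lt_or_eq
  · simpa using List.pairwise_iff_getElem.1 (h x) _ _ hi hi' hlt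
  · rw [(List.idxOf_inj (hact _ hsrc x)).1 heq]

theorem selectsLowest_ageRule (hX : Nat.card X = 1) :
    SelectsLowest A ge (ageRule ge) SortedByAge where
  init x := List.pairwise_singleton _ _
  delay ℓ ν t h x := (h x).imp fun hle => add_le_add_left hle t
  next ℓ ν a K _ _ h := h.next K
  lowest ℓ ν a K hK hact h e he := by
    classical
    obtain ⟨hsub, ⟨x₀⟩⟩ := Nat.card_eq_one_iff_unique.1 hX
    have hkept : ∃ e₀, kept (ageRule ge) ℓ K e.tgt = some e₀ := by
      let E : Set (Arrow Q X) := {e' | e' ∈ arrows K ∧ e'.tgt = e.tgt}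
      have hfin : E.Finite := (arrows K).finite_toSet.subset fun _ h => h.1
      have hne : E.Nonempty := ⟨e, he, rfl⟩
      by_cases hge : e.tgt ∈ ge
      · obtain ⟨e₁, ⟨he₁, htgt⟩, hmax⟩ := hfin.exists_maximalFor (recency ℓ · x₀) E hne
        rw [← htgt]
        refine exists_kept he₁ fun e' he' htgt' => ⟨fun _ x => ?_, fun h => ?_⟩
        · rw [Subsingleton.elim x x₀]
          exact (le_total _ _).elim id fun hle => hmax ⟨he', htgt'.trans htgt⟩ hle
        · exact absurd (htgt ▸ hge) h
      · obtain ⟨e₁, ⟨he₁, htgt⟩, hmin⟩ := hfin.exists_minimalFor (recency ℓ · x₀) E hne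
        rw [← htgt]
        refine exists_kept he₁ fun e' he' htgt' => ⟨fun h => ?_, fun _ x => ?_⟩
        · exact absurd (htgt ▸ h) hge
        · rw [Subsingleton.elim x x₀]
          exact (le_total _ _).elim id fun hle => hmin ⟨he', htgt'.trans htgt⟩ hle
    obtain ⟨e₀, he₀⟩ := hkept
    refine ⟨e₀, he₀, ?_⟩
    obtain ⟨hmem, htgt, hbest⟩ := kept_spec he₀
    have hrule := hbest e he rfl
    have hsrc := (edge_of_mem_arrows hK he).1
    have hsrc₀ := (edge_of_mem_arrows hK hmem).1
    exact ⟨htgt,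
      fun hge x => h.resetVal_le_of_recency_le hact hsrc hsrc₀ (hrule.1 hge x),
      fun hge x => h.resetVal_le_of_recency_le hact hsrc₀ hsrc (hrule.2 hge x)⟩

end Construction

end TimedATA

theorem mainTheorem6 {Q Sig X : Type*} [Fintype Q] [Finite Sig] [Finite X]
    (A : TimedATA.ATA Q Sig X) (ge : Set Q) (hA : A.IsUnilateral ge)
    (rule : TimedATA.Rule Q X)
    (hrule : (A.IsVeryWeak ∧ rule = TimedATA.selfLoopRule ge) ∨
      (Nat.card X = 1 ∧ rule = TimedATA.ageRule ge)) :
    (TimedATA.subsetNTA A rule).IsNTA ∧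
    (TimedATA.subsetNTA A rule).ts.SimEquiv (A.redTS ge) ∧
    (TimedATA.subsetNTA A rule).ts.SimEquiv (A.redRunTS ge) ∧
    A.finLang = (TimedATA.subsetNTA A rule).finLang ∧
    A.infLang = (TimedATA.subsetNTA A rule).infLang := by
  have hsim : A.ts.SimEquiv (TimedATA.subsetNTA A rule).ts := by
    obtain ⟨hw, rfl⟩ | ⟨hX, rfl⟩ := hrule
    · exact (TimedATA.selectsLowest_selfLoopRule hw).simEquiv hA
    · exact (TimedATA.selectsLowest_ageRule hX).simEquiv hA
  refine ⟨TimedATA.isNTA_subsetNTA A rule, hsim.symm.trans hA.simEquiv_redTS,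
    hsim.symm.trans hA.simEquiv_redRunTS, ?_, ?_⟩
  · ext ρ
    exact and_congr_right fun _ => hsim.accepts_iff _
  · ext ρ
    exact and_congr_right fun _ => hsim.buchiAccepts_iff _
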